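/- Let $\mathcal{P}$ be a real affine plane (a principal homogeneous space under a real vector space of dimension $2$, with its usual topology) and let $\pi:\mathcal{P}\to\mathbb{R}$ be a non-constant affine function; the fibres of $\pi$ are called vertical lines. Let $\mathcal{D}\subseteq\mathcal{P}$ be an algebraic domain, that is, a non-empty closed subset which is homeomorphic to a surface with (possibly empty) boundary, and whose boundary $\mathcal{C}=\partial\mathcal{D}$ is a disjoint union of finitely many smooth connected components of real algebraic curves (each one is a connected component of the zero locus of a real polynomial in two variables whose gradient does not vanish at any point of this component). Then the following conditions are equivalent: 1. $\mathcal{D}$ is a domain of finite type: $\mathcal{D}$ is a closed subset homeomorphic to a surface with non-empty boundary, the restriction $\pi|_{\mathcal{D}}:\mathcal{D}\to\mathbb{R}$ is proper, and the topological critical set of $\mathcal{C}$ is finite. Here the topological critical set consists of the points of $\mathcal{C}$ none of whose neighbourhoods in $\mathcal{C}$ is mapped by $\pi$ homeomorphically onto its image. 2. The restriction $\pi|_{\mathcal{D}}:\mathcal{D}\to\mathbb{R}$ is proper. 3. At least one fibre of $\pi|_{\mathcal{D}}:\mathcal{D}\to\mathbb{R}$ is compact, and $\mathcal{C}$ contains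 no vertical line and has no vertical asymptote. Here $\mathcal{C}$ has a vertical asymptote if there are $t\in\mathbb{R}$ and a continuous injective map $\gamma:[0,\infty)\to\mathcal{C}$ such that $\gamma(s)$ leaves every compact subset of $\mathcal{P}$ and $\pi(\gamma(s))\to t$ as $s\to\infty$. -/

import Mathlib

open Topology Filter

namespace AlgDomain

section Topological

variable {P : Type*} [TopologicalSpace P]

/-- The topological critical set of the projection `π` restricted to `C`: the points of `C` none of
whose neighbourhoods in `C` is mapped by `π` homeomorphically onto its image. -/
def topCriticalSet (π : P → ℝ) (C : Set P) : Set P :=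
  {p | p ∈ C ∧ ¬ ∃ U : Set P, IsOpen U ∧ p ∈ U ∧ IsEmbedding ((U ∩ C).domRestrict π)}

/-- `D`, with the subspace topology, is a topological surface with (possibly empty) boundary:
every point has a neighbourhood homeomorphic to an open subset of the closed half-plane. -/
def IsSurfaceWithBoundary (D : Set P) : Prop :=
  Nonempty (ChartedSpace (EuclideanHalfSpace 2) D)

/-- Domains of finite type relative to the projection `π` of a vertical plane `P`. The boundary of
a closed subsurface `D` of the plane is its frontier. -/
structure IsDomainOfFiniteType (π : P → ℝ) (D : Set P) : Prop where
  isClosed : IsClosed D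
  isSurface : IsSurfaceWithBoundary D
  boundary_nonempty : (frontier D).Nonempty
  isProper : IsProperMap (D.domRestrict π)
  finite_critical : (topCriticalSet π (frontier D)).Finite

/-- `C` contains a whole vertical line, that is, a fibre of `π`. -/
def ContainsVerticalLine (π : P → ℝ) (C : Set P) : Prop :=
  ∃ t : ℝ, π ⁻¹' {t} ⊆ C

/-- Some vertical line `π = t` is an asymptote of `C`: an arc of `C`, parametrized by `[0, ∞)`,
goes to infinity in the plane while approaching this line. -/
def HasVerticalAsymptote (π : P → ℝ) (C : Set P) : Prop :=
  ∃ (t : ℝ) (γ : NNReal → P), Continuous γ ∧ Function.Injective γ ∧ (∀ s, γ s ∈ C) ∧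
    Tendsto γ atTop (cocompact P) ∧ Tendsto (fun s => π (γ s)) atTop (𝓝 t)

end Topological

section Affine

variable {V P : Type*} [AddCommGroup V] [Module ℝ V] [AddTorsor V P] [TopologicalSpace P]

/-- `K` is a smooth connected component of a real algebraic curve of the affine plane `P`: in some
affine coordinates `e` it is a connected component of the zero locus of a polynomial `F`, and the
gradient of `F` vanishes nowhere on `K` (in particular, `F` is not constant). -/
def IsSmoothCurveComponent (K : Set P) : Prop :=
  ∃ (e : P ≃ᵃ[ℝ] (Fin 2 → ℝ)) (F : MvPolynomial (Fin 2) ℝ),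
    (∃ p : P, MvPolynomial.eval (e p) F = 0 ∧
      K = connectedComponentIn {q : P | MvPolynomial.eval (e q) F = 0} p) ∧
    ∀ p ∈ K, ∃ i : Fin 2, MvPolynomial.eval (e p) (MvPolynomial.pderiv i F) ≠ 0

/-- Algebraic domains of an affine plane `P`: closed subsurfaces whose boundary is a disjoint
union of finitely many smooth connected components of real algebraic curves. -/
structure IsAlgebraicDomain (D : Set P) : Prop where
  isClosed : IsClosed D
  isSurface : IsSurfaceWithBoundary D
  boundary_algebraic : ∃ 𝒦 : Set (Set P), 𝒦.Finite ∧ 𝒦.PairwiseDisjoint id ∧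
    (∀ K ∈ 𝒦, IsSmoothCurveComponent K) ∧ frontier D = ⋃₀ 𝒦

end Affine

end AlgDomain

/-!
Choose affine coordinates of the plane in which `π` is the first projection of `ℝ × ℝ`, and let `K`
be a component of the boundary, contained in a curve `G = 0`.

*Critical points.* If a prime factor `F` of `G` involves `y`, its vertical tangencies lie over the
roots of the non-zero resultant of `F` and `∂F/∂y`. If `K` contains no vertical line, its fibres are
finite, so `K` has finitely many vertical tangencies, and it is a graph around any other point.

*Properness of `K`.* Over the points `x ≠ t` near `t`, the leading coefficient of `G` in `y` does
not vanish and `K` has no vertical tangency, so the maximum `g x` of the fibre of `K` over `x`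
depends continuously on `x`. If `g` is unbounded at `t⁺`, it tends to infinity, as otherwise it
would take every large value arbitrarily close to `t` and the fibre over `t` would be unbounded;
the graph of `g` is then a vertical asymptote. The other three quadrants follow by symmetry.

*Properness of `D`.* If the part of `∂D` over a segment `I` lies below the height `c`, then
`I × (c, ∞)` is either contained in `D` or disjoint from it, and a compact fibre over a point of `I`
excludes the former.
-/

namespace AlgDomain

section VerticalTangencies

open Polynomial
open scoped Polynomial.Bivariate

variable {R : Type*} [CommRing R]

/-- The abscissae of the smooth points with vertical tangent of the affine curve `F = 0` that do
not lie on a vertical line contained in the curve. -/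
def verticalTangencies (F : R[X][Y]) : Set R :=
  {x | ∃ y, F.evalEval x y = 0 ∧ (derivative F).evalEval x y = 0 ∧
    (derivative (F.eval (C y))).eval x ≠ 0 ∧ F.map (evalRingHom x) ≠ 0}

theorem verticalTangencies_C (r : R[X]) : verticalTangencies (C r : R[X][Y]) = ∅ := by
  refine Set.eq_empty_of_forall_notMem fun x ⟨y, h0, _, _, hm⟩ => hm ?_
  rw [evalEval_C] at h0
  rw [map_C, coe_evalRingHom, h0, C_0]

theorem isRoot_resultant_of_evalEval_eq_zero {F G : R[X][Y]} (hF : F.natDegree ≠ 0) {x y : R}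
    (hFxy : F.evalEval x y = 0) (hGxy : G.evalEval x y = 0) : (F.resultant G).IsRoot x := by
  obtain ⟨p, q, -, -, h⟩ := exists_mul_add_mul_eq_C_resultant F G le_rfl le_rfl (Or.inl hF)
  have h' := congrArg (evalEval x y) h
  rwa [evalEval_add, evalEval_mul, evalEval_mul, hFxy, hGxy, zero_mul, zero_mul, zero_add,
    evalEval_C, eq_comm] at h'

theorem resultant_derivative_ne_zero_of_prime [IsDomain R] [UniqueFactorizationMonoid R]
    [CharZero R] {F : R[X]} (hF : Prime F) (hd : F.natDegree ≠ 0) :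
    F.resultant (derivative F) ≠ 0 := by
  set φ := algebraMap R (FractionRing R)
  have hφ : Function.Injective φ := IsFractionRing.injective _ _
  have : CharZero (FractionRing R) := charZero_of_injective_algebraMap hφ
  have hirr : Irreducible (F.map φ) :=
    (hF.irreducible.isPrimitive hd).irreducible_iff_irreducible_map_fraction_map.1 hF.irreducible
  have hres : (F.map φ).resultant (derivative (F.map φ)) ≠ 0 := fun h =>
    (resultant_eq_zero_iff.1 h).2 hirr.separable
  rw [derivative_map, natDegree_map_eq_of_injective hφ, natDegree_map_eq_of_injective hφ,
    resultant_map_map] at hres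
  exact ne_zero_of_map hres

variable [IsDomain R]

theorem verticalTangencies_of_isUnit {F : R[X][Y]} (hF : IsUnit F) : verticalTangencies F = ∅ :=
  Set.eq_empty_of_forall_notMem fun x ⟨y, h0, _⟩ => (hF.map (evalEvalRingHom x y)).ne_zero h0

theorem verticalTangencies_mul_subset (F G : R[X][Y]) :
    verticalTangencies (F * G) ⊆ verticalTangencies F ∪ verticalTangencies G := by
  rintro x ⟨y, h0, hy, hx, hm⟩
  rw [evalEval_mul] at h0
  rw [derivative_mul, evalEval_add, evalEval_mul, evalEval_mul] at hy
  rw [eval_mul, derivative_mul, eval_add, eval_mul, eval_mul] at hx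
  rw [Polynomial.map_mul] at hm
  change _ * G.evalEval x y + F.evalEval x y * _ ≠ 0 at hx
  rcases mul_eq_zero.1 h0 with hF | hG
  · rw [hF, zero_mul, add_zero] at hx hy
    exact Or.inl ⟨y, hF, (mul_eq_zero.1 hy).resolve_right (right_ne_zero_of_mul hx),
      left_ne_zero_of_mul hx, left_ne_zero_of_mul hm⟩
  · rw [hG, mul_zero, zero_add] at hx hy
    exact Or.inr ⟨y, hG, (mul_eq_zero.1 hy).resolve_left (left_ne_zero_of_mul hx),
      right_ne_zero_of_mul hx, right_ne_zero_of_mul hm⟩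

theorem finite_verticalTangencies [UniqueFactorizationMonoid R] [CharZero R] (F : R[X][Y]) :
    (verticalTangencies F).Finite := by
  induction F using UniqueFactorizationMonoid.induction_on_prime with
  | h₁ => exact C_0 (R := R[X]) ▸ verticalTangencies_C (0 : R[X]) ▸ Set.finite_empty
  | h₂ u hu => exact verticalTangencies_of_isUnit hu ▸ Set.finite_empty
  | h₃ F p _ hp ih =>
    refine Set.Finite.subset (Set.Finite.union ?_ ih) (verticalTangencies_mul_subset p F)
    by_cases hd : p.natDegree = 0
    · obtain ⟨r, rfl⟩ := natDegree_eq_zero.1 hd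
      exact verticalTangencies_C r ▸ Set.finite_empty
    · refine (finite_setOfPred_isRoot (resultant_derivative_ne_zero_of_prime hp hd)).subset ?_
      rintro x ⟨y, h0, hy, -⟩
      exact isRoot_resultant_of_evalEval_eq_zero hd h0 hy

end VerticalTangencies

section ProperProjection

variable {X Y : Type*} [TopologicalSpace X] [TopologicalSpace Y]

theorem forall_nonempty_of_hemicontinuousAt {F : X → Set Y} {I : Set X}
    (hI : IsPreconnected I) (hl : ∀ x ∈ I, LowerHemicontinuousAt F x)
    (hu : ∀ x ∈ I, UpperHemicontinuousAt F x) (hne : ∃ x ∈ I, (F x).Nonempty) :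
    ∀ x ∈ I, (F x).Nonempty := by
  intro x hx
  obtain ⟨x₀, hx₀, hne₀⟩ := hne
  refine (hI.induction₂ (fun a b => (F a).Nonempty ↔ (F b).Nonempty) (fun a ha => ?_)
    (fun a b c _ _ _ => Iff.trans) (fun a b _ _ => Iff.symm) hx₀ hx).1 hne₀
  refine eventually_nhdsWithin_of_eventually_nhds ?_
  rcases (F a).eq_empty_or_nonempty with hempty | hnonempty
  · filter_upwards [(hu a ha).forall_isOpen ∅ isOpen_empty hempty.subset] with b hb
    simp only [hempty, Set.subset_empty_iff.1 hb]
  · filter_upwards [hl a ha Set.univ ⟨isOpen_univ, by rwa [Set.inter_univ]⟩] with b hb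
    exact iff_of_true hnonempty (hb.2.mono Set.inter_subset_left)

theorem continuousAt_sSup_of_hemicontinuousAt [ConditionallyCompleteLinearOrder Y]
    [OrderTopology Y] {F : X → Set Y} {x : X} (hl : LowerHemicontinuousAt F x)
    (hu : UpperHemicontinuousAt F x) (hne : (F x).Nonempty)
    (hc : ∀ᶠ x' in 𝓝 x, IsCompact (F x')) : ContinuousAt (fun x => sSup (F x)) x := by
  have hne' : ∀ᶠ x' in 𝓝 x, (F x').Nonempty :=
    (hl Set.univ ⟨isOpen_univ, by rwa [Set.inter_univ]⟩).mono fun _ h =>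
      h.2.mono Set.inter_subset_left
  refine tendsto_order.2 ⟨fun c hlt => ?_, fun c hlt => ?_⟩
  · obtain ⟨y, hy, hcy⟩ := exists_lt_of_lt_csSup hne hlt
    filter_upwards [hl (Set.Ioi c) ⟨isOpen_Ioi, y, hy, hcy⟩, hc] with x' ⟨_, y', hy', hcy'⟩ hc'
    exact hcy'.trans_le (le_csSup hc'.bddAbove hy')
  · have hsub : F x ⊆ Set.Iio c := fun y hy =>
      (le_csSup hc.self_of_nhds.bddAbove hy).trans_lt hlt
    filter_upwards [hu.forall_isOpen _ isOpen_Iio hsub, hc, hne'] with x' hx' hc' hne'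
    exact hx' (hc'.sSup_mem hne')

/-- The set `K` is proper over `x` if the fibres of `K` over a neighbourhood of `x` lie in a common
compact set. A closed set that is proper over each point projects properly to the first factor. -/
def IsProperAt (K : Set (X × Y)) (x : X) : Prop :=
  ∃ C, IsCompact C ∧ ∀ᶠ x' in 𝓝 x, Prod.mk x' ⁻¹' K ⊆ C

variable {K : Set (X × Y)} {x : X}

theorem IsProperAt.eventually (h : IsProperAt K x) : ∀ᶠ x' in 𝓝 x, IsProperAt K x' :=
  let ⟨C, hC, hx⟩ := h
  (eventually_eventually_nhds.2 hx).mono fun _ hx' => ⟨C, hC, hx'⟩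

theorem IsProperAt.isCompact_fiber (h : IsProperAt K x) (hK : IsClosed K) :
    IsCompact (Prod.mk x ⁻¹' K) :=
  let ⟨_, hC, hx⟩ := h
  hC.of_isClosed_subset (hK.preimage (Continuous.prodMk_right x)) hx.self_of_nhds

theorem IsProperAt.upperHemicontinuousAt (h : IsProperAt K x) (hK : IsClosed K) :
    UpperHemicontinuousAt (fun x => Prod.mk x ⁻¹' K) x := by
  obtain ⟨C, hC, hx⟩ := h
  refine UpperHemicontinuousAt.of_forall_isOpen fun U hU hxU => ?_
  have hev : ∀ᶠ x' in 𝓝 x, ∀ y ∈ C, (x', y) ∈ K → y ∈ U := by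
    refine hC.eventually_forall_of_forall_eventually fun y _ => ?_
    by_cases hy : (x, y) ∈ K
    · filter_upwards [continuous_snd.continuousAt.preimage_mem_nhds (hU.mem_nhds (hxU hy))]
        with z hz _ using hz
    · filter_upwards [hK.isOpen_compl.mem_nhds hy] with z hz hzK using absurd hzK hz
  filter_upwards [hx, hev] with x' hx' hU' y hy using hU' y (hx' hy) hy

theorem isProperMap_fst_of_forall_isProperAt (hK : IsClosed K) (h : ∀ x, IsProperAt K x) :
    IsProperMap (K.domRestrict Prod.fst) := by
  refine isProperMap_iff_ultrafilter.2
    ⟨continuous_fst.comp continuous_subtype_val, fun 𝒰 x hx => ?_⟩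
  obtain ⟨C, hC, hxC⟩ := h x
  have hmem : ∀ᶠ w : K in 𝒰, w.1.2 ∈ C := by
    filter_upwards [hx.eventually hxC] with w hw using hw w.2
  obtain ⟨y, -, hy⟩ := hC.ultrafilter_le_nhds (𝒰.map fun w : K => w.1.2) (le_principal_iff.2 hmem)
  have hxy : Tendsto (Subtype.val : K → X × Y) 𝒰 (𝓝 (x, y)) := hx.prodMk_nhds hy
  exact ⟨⟨(x, y), hK.mem_of_tendsto hxy (Eventually.of_forall Subtype.prop)⟩, rfl,
    tendsto_subtype_rng.2 hxy⟩

theorem continuousOn_sSup_fiber [ConditionallyCompleteLinearOrder Y] [OrderTopology Y]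
    (hK : IsClosed K) {I : Set X} (hI : IsPreconnected I)
    (hl : ∀ x ∈ I, LowerHemicontinuousAt (fun x => Prod.mk x ⁻¹' K) x)
    (hp : ∀ x ∈ I, IsProperAt K x) (hne : ∃ x ∈ I, (Prod.mk x ⁻¹' K).Nonempty) :
    ContinuousOn (fun x => sSup (Prod.mk x ⁻¹' K)) I ∧
      ∀ x ∈ I, IsGreatest (Prod.mk x ⁻¹' K) (sSup (Prod.mk x ⁻¹' K)) := by
  have hu : ∀ x ∈ I, UpperHemicontinuousAt (fun x => Prod.mk x ⁻¹' K) x :=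
    fun x hx => (hp x hx).upperHemicontinuousAt hK
  have hne' := forall_nonempty_of_hemicontinuousAt hI hl hu hne
  refine ⟨fun x hx => ContinuousAt.continuousWithinAt ?_, fun x hx => ?_⟩
  · exact continuousAt_sSup_of_hemicontinuousAt (hl x hx) (hu x hx) (hne' x hx)
      ((hp x hx).eventually.mono fun x' hx' => hx'.isCompact_fiber hK)
  · exact ((hp x hx).isCompact_fiber hK).isGreatest_sSup (hne' x hx)

end ProperProjection

section Asymptotes

theorem frequently_nhdsGT_eq_of_continuousOn {X Y : Type*} [ConditionallyCompleteLinearOrder X]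
    [DenselyOrdered X] [TopologicalSpace X] [OrderTopology X] [LinearOrder Y]
    [TopologicalSpace Y] [OrderClosedTopology Y] {g : X → Y} {t u : X} {c : Y} (hu : t < u)
    (hg : ContinuousOn g (Set.Ioo t u)) (hle : ∃ᶠ x in 𝓝[>] t, g x ≤ c)
    (hge : ∃ᶠ x in 𝓝[>] t, c ≤ g x) : ∃ᶠ x in 𝓝[>] t, g x = c := by
  rw [(nhdsGT_basis_of_exists_gt ⟨u, hu⟩).frequently_iff]
  intro v hv
  have hIoo : Set.Ioo t (min u v) ∈ 𝓝[>] t := Ioo_mem_nhdsGT (lt_min hu hv)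
  obtain ⟨a, ha, ha'⟩ := (hle.and_eventually hIoo).exists
  obtain ⟨b, hb, hb'⟩ := (hge.and_eventually hIoo).exists
  obtain ⟨x, hx, hxc⟩ := isPreconnected_Ioo.intermediate_value ha' hb'
    (hg.mono (Set.Ioo_subset_Ioo_right (min_le_left u v))) ⟨ha, hb⟩
  exact ⟨x, ⟨hx.1, hx.2.trans_le (min_le_right u v)⟩, hxc⟩

theorem exists_continuous_injective_tendsto_nhdsGT {t u : ℝ} (hu : t < u) :
    ∃ f : NNReal → ℝ, Continuous f ∧ Function.Injective f ∧ (∀ s, f s ∈ Set.Ioo t u) ∧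
      Tendsto f atTop (𝓝[>] t) := by
  have hut : 0 < u - t := sub_pos.2 hu
  have hpos : ∀ s : NNReal, (0 : ℝ) < 2 + s := fun s => by positivity
  have hmem : ∀ s : NNReal, t + (u - t) / (2 + s) ∈ Set.Ioo t u := fun s => by
    have hlt : (u - t) / (2 + s) < u - t := div_lt_self hut (by linarith [s.coe_nonneg])
    exact ⟨lt_add_of_pos_right t (div_pos hut (hpos s)), by linarith⟩
  refine ⟨fun s => t + (u - t) / (2 + s), ?_, fun s s' h => ?_, hmem,
    tendsto_nhdsWithin_iff.2 ⟨?_, Eventually.of_forall fun s => (hmem s).1⟩⟩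
  · exact continuous_const.add (continuous_const.div
      (continuous_const.add NNReal.continuous_coe) fun s => (hpos s).ne')
  · have h' : (2 : ℝ) + s = 2 + s' := by
      rwa [add_right_inj, div_eq_div_iff (hpos s).ne' (hpos s').ne', mul_right_inj' hut.ne',
        eq_comm] at h
    exact NNReal.coe_injective (add_left_cancel h')
  · have htop : Tendsto (fun s : NNReal => (2 : ℝ) + s) atTop atTop :=
      tendsto_atTop_add_const_left _ _ (NNReal.tendsto_coe_atTop.2 tendsto_id)
    simpa only [add_zero] using (htop.const_div_atTop (u - t)).const_add t

theorem HasVerticalAsymptote.of_preimage {P Q : Type*} [TopologicalSpace P] [TopologicalSpace Q]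
    {π : P → ℝ} {ρ : Q → ℝ} {K : Set Q} {φ : P → Q} (hφ : IsClosedEmbedding φ) {r : ℝ → ℝ}
    (hr : Continuous r) (hρ : ∀ p, ρ (φ p) = r (π p)) (h : HasVerticalAsymptote π (φ ⁻¹' K)) :
    HasVerticalAsymptote ρ K := by
  obtain ⟨t, γ, hcont, hinj, hmem, hinf, ht⟩ := h
  refine ⟨r t, φ ∘ γ, hφ.continuous.comp hcont, hφ.injective.comp hinj, hmem,
    hφ.tendsto_cocompact.comp hinf, ?_⟩
  simpa only [Function.comp_def, hρ] using (hr.tendsto t).comp ht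

variable {Y : Type*} [TopologicalSpace Y] {K : Set (ℝ × Y)} {t : ℝ}

theorem hasVerticalAsymptote_of_tendsto_cocompact {g : ℝ → Y} {u : ℝ} (hu : t < u)
    (hg : ContinuousOn g (Set.Ioo t u)) (hgK : ∀ x ∈ Set.Ioo t u, (x, g x) ∈ K)
    (hinf : Tendsto g (𝓝[>] t) (cocompact Y)) : HasVerticalAsymptote Prod.fst K := by
  obtain ⟨f, hf, hinj, hmem, hft⟩ := exists_continuous_injective_tendsto_nhdsGT hu
  refine ⟨t, fun s => (f s, g (f s)), hf.prodMk (hg.comp_continuous hf hmem),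
    fun s s' h => hinj (congrArg Prod.fst h), fun s => hgK _ (hmem s), ?_,
    hft.mono_right nhdsWithin_le_nhds⟩
  have hsnd : Tendsto (fun s => (f s, g (f s))) atTop (comap Prod.snd (cocompact Y)) :=
    tendsto_comap_iff.2 (hinf.comp hft)
  exact hsnd.mono_right (comap_cocompact_le continuous_snd)

variable [ConditionallyCompleteLinearOrder Y] [OrderTopology Y]

theorem tendsto_nhdsGT_atTop_of_frequently_le [NoMaxOrder Y] {g : ℝ → Y} {u : ℝ}
    (hK : IsClosed K) (ht : BddAbove (Prod.mk t ⁻¹' K)) (hu : t < u)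
    (hg : ContinuousOn g (Set.Ioo t u)) (hgK : ∀ x ∈ Set.Ioo t u, (x, g x) ∈ K)
    (hlarge : ∀ M, ∃ᶠ x in 𝓝[>] t, M ≤ g x) : Tendsto g (𝓝[>] t) atTop := by
  by_contra hbdd
  obtain ⟨M, hM⟩ := not_forall.1 (mt tendsto_atTop.2 hbdd)
  obtain ⟨c, hc⟩ := ht
  obtain ⟨d, hd⟩ := exists_gt (max M c)
  -- `g` takes the value `d` arbitrarily close to `t`, so `d` belongs to the fibre over `t`.
  have hfreq : ∃ᶠ x in 𝓝[>] t, g x = d := frequently_nhdsGT_eq_of_continuousOn hu hg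
    ((not_eventually.1 hM).mono fun x hx => (not_le.1 hx).le.trans ((le_max_left M c).trans hd.le))
    (hlarge d)
  have hfreqK : ∃ᶠ x in 𝓝 t, (x, d) ∈ K :=
    ((hfreq.and_eventually (Ioo_mem_nhdsGT hu)).filter_mono nhdsWithin_le_nhds).mono
      fun x ⟨hxd, hx⟩ => hxd ▸ hgK x hx
  have htd : (t, d) ∈ K := (hK.preimage (Continuous.prodMk_left d)).closure_subset
    (mem_closure_iff_frequently.2 hfreqK)
  exact ((le_max_right M c).trans_lt hd).not_ge (hc htd)

theorem exists_eventually_nhdsGT_fiber_subset_Iic [NoMaxOrder Y] (hK : IsClosed K)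
    (ht : BddAbove (Prod.mk t ⁻¹' K))
    (hlp : ∀ᶠ x in 𝓝[>] t, LowerHemicontinuousAt (fun x => Prod.mk x ⁻¹' K) x ∧ IsProperAt K x)
    (ha : ¬ HasVerticalAsymptote Prod.fst K) :
    ∃ M, ∀ᶠ x in 𝓝[>] t, Prod.mk x ⁻¹' K ⊆ Set.Iic M := by
  by_contra! hunb
  simp only [Set.not_subset, Set.mem_Iic, not_le] at hunb
  obtain ⟨u, hu, hIoo⟩ := mem_nhdsGT_iff_exists_Ioo_subset.1 hlp
  have hmem : ∀ᶠ x in 𝓝[>] t, x ∈ Set.Ioo t u := Ioo_mem_nhdsGT hu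
  obtain ⟨c, hc⟩ := ht
  obtain ⟨x₀, ⟨y₀, hy₀, -⟩, hx₀⟩ := ((hunb c).and_eventually hmem).exists
  obtain ⟨hcont, hmax⟩ := continuousOn_sSup_fiber hK isPreconnected_Ioo
    (fun x hx => (hIoo hx).1) (fun x hx => (hIoo hx).2) ⟨x₀, hx₀, y₀, hy₀⟩
  have hlarge : ∀ M, ∃ᶠ x in 𝓝[>] t, M ≤ sSup (Prod.mk x ⁻¹' K) := fun M =>
    ((hunb M).and_eventually hmem).mono fun x ⟨⟨y, hy, hMy⟩, hx⟩ =>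
      hMy.le.trans ((hmax x hx).2 hy)
  have htop := tendsto_nhdsGT_atTop_of_frequently_le hK ⟨c, hc⟩ hu hcont
    (fun x hx => (hmax x hx).1) hlarge
  exact ha (hasVerticalAsymptote_of_tendsto_cocompact hu hcont (fun x hx => (hmax x hx).1)
    (htop.mono_right atTop_le_cocompact))

variable [NoMaxOrder Y] [NoMinOrder Y]

theorem exists_isCompact_eventually_nhdsGT_fiber_subset (hK : IsClosed K)
    (ht : IsCompact (Prod.mk t ⁻¹' K))
    (hlp : ∀ᶠ x in 𝓝[>] t, LowerHemicontinuousAt (fun x => Prod.mk x ⁻¹' K) x ∧ IsProperAt K x)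
    (ha : ¬ HasVerticalAsymptote Prod.fst K) :
    ∃ C, IsCompact C ∧ ∀ᶠ x in 𝓝[>] t, Prod.mk x ⁻¹' K ⊆ C := by
  obtain ⟨M, hM⟩ := exists_eventually_nhdsGT_fiber_subset_Iic hK ht.bddAbove hlp ha
  obtain ⟨m, hm⟩ := exists_eventually_nhdsGT_fiber_subset_Iic (Y := Yᵒᵈ) hK ht.bddBelow hlp ha
  exact ⟨Set.Icc m M, isCompact_Icc,
    (hm.and hM).mono fun x hx y hy => ⟨hx.1 hy, hx.2 hy⟩⟩

theorem exists_isCompact_eventually_nhdsLT_fiber_subset (hK : IsClosed K)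
    (ht : IsCompact (Prod.mk t ⁻¹' K))
    (hlp : ∀ᶠ x in 𝓝[<] t, LowerHemicontinuousAt (fun x => Prod.mk x ⁻¹' K) x ∧ IsProperAt K x)
    (ha : ¬ HasVerticalAsymptote Prod.fst K) :
    ∃ C, IsCompact C ∧ ∀ᶠ x in 𝓝[<] t, Prod.mk x ⁻¹' K ⊆ C := by
  let φ : ℝ × Y ≃ₜ ℝ × Y := (Homeomorph.neg ℝ).prodCongr (Homeomorph.refl Y)
  have hφ : ∀ x, Prod.mk (-x) ⁻¹' (φ ⁻¹' K) = Prod.mk x ⁻¹' K := fun x =>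
    Set.ext fun y => by simp [φ]
  have hneg : Tendsto (fun x : ℝ => -x) (𝓝[>] (-t)) (𝓝[<] t) := by
    simpa only [neg_neg] using tendsto_neg_nhdsGT (a := -t)
  obtain ⟨C, hC, hsub⟩ := exists_isCompact_eventually_nhdsGT_fiber_subset (t := -t)
    (hK.preimage φ.continuous) (hφ t ▸ ht)
    ((hneg.eventually hlp).mono fun x ⟨hl, C, hC, hsub⟩ =>
      ⟨fun U hU => (continuous_neg.tendsto x).eventually (hl U hU), C, hC,
        (continuous_neg.tendsto x).eventually hsub⟩)
    (mt (HasVerticalAsymptote.of_preimage φ.isClosedEmbedding continuous_neg fun _ => rfl) ha)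
  exact ⟨C, hC, (tendsto_neg_nhdsLT.eventually hsub).mono fun x hx => hφ x ▸ hx⟩

theorem isProperAt_of_not_hasVerticalAsymptote (hK : IsClosed K)
    (ht : IsCompact (Prod.mk t ⁻¹' K))
    (hlp : ∀ᶠ x in 𝓝[≠] t, LowerHemicontinuousAt (fun x => Prod.mk x ⁻¹' K) x ∧ IsProperAt K x)
    (ha : ¬ HasVerticalAsymptote Prod.fst K) : IsProperAt K t := by
  rw [← nhdsLT_sup_nhdsGT, eventually_sup] at hlp
  obtain ⟨C₁, hC₁, hlt⟩ := exists_isCompact_eventually_nhdsLT_fiber_subset hK ht hlp.1 ha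
  obtain ⟨C₂, hC₂, hgt⟩ := exists_isCompact_eventually_nhdsGT_fiber_subset hK ht hlp.2 ha
  refine ⟨C₁ ∪ C₂ ∪ Prod.mk t ⁻¹' K, (hC₁.union hC₂).union ht, ?_⟩
  have hne : ∀ᶠ x in 𝓝[≠] t, Prod.mk x ⁻¹' K ⊆ C₁ ∪ C₂ ∪ Prod.mk t ⁻¹' K := by
    rw [← nhdsLT_sup_nhdsGT, eventually_sup]
    exact ⟨hlt.mono fun x hx y hy => Or.inl (Or.inl (hx hy)),
      hgt.mono fun x hx y hy => Or.inl (Or.inr (hx hy))⟩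
  rw [← pure_sup_nhdsNE, eventually_sup]
  exact ⟨Set.subset_union_right, hne⟩

end Asymptotes

section ImplicitFunction

theorem exists_openPartialHomeomorph_eq_prodMk {𝕜 E₁ E₂ F : Type*} [NontriviallyNormedField 𝕜]
    [NormedAddCommGroup E₁] [NormedSpace 𝕜 E₁] [CompleteSpace E₁]
    [NormedAddCommGroup E₂] [NormedSpace 𝕜 E₂] [CompleteSpace E₂]
    [NormedAddCommGroup F] [NormedSpace 𝕜 F] [CompleteSpace F] {f : E₁ × E₂ → F}
    {f' : E₁ × E₂ →L[𝕜] F} {z : E₁ × E₂} (hf : HasStrictFDerivAt f f' z)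
    (hf' : (f' ∘L .inr 𝕜 E₁ E₂).IsInvertible) :
    ∃ e : OpenPartialHomeomorph (E₁ × E₂) (F × E₁), z ∈ e.source ∧ ∀ w, e w = (f w, w.1) :=
  let φ := hf.implicitFunctionDataOfProdDomain hf'
  ⟨φ.toOpenPartialHomeomorph, φ.pt_mem_toOpenPartialHomeomorph_source,
    φ.toOpenPartialHomeomorph_apply⟩

variable {X Y Z : Type*} [TopologicalSpace X] [TopologicalSpace Y] [TopologicalSpace Z]
  {f : X × Y → Z} {e : OpenPartialHomeomorph (X × Y) (Z × X)} {c : Z}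

theorem isEmbedding_fst_source_inter_fiber (he : ∀ w, e w = (f w, w.1)) :
    IsEmbedding ((e.source ∩ f ⁻¹' {c}).domRestrict Prod.fst) := by
  have hcomp : Prod.mk c ∘ (e.source ∩ f ⁻¹' {c}).domRestrict Prod.fst =
      e.source.domRestrict e ∘ Set.inclusion Set.inter_subset_left :=
    funext fun w => Prod.ext (w.2.2.symm.trans (congrArg Prod.fst (he w.1)).symm)
      (congrArg Prod.snd (he w.1)).symm
  refine .of_comp (continuous_fst.comp continuous_subtype_val) (.prodMk_right c) (hcomp ▸ ?_)
  exact e.isOpenEmbedding_restrict.isEmbedding.comp (.inclusion Set.inter_subset_left)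

theorem eventually_fiber_connectedComponentIn_inter_nonempty [LocallyConnectedSpace X]
    (he : ∀ w, e w = (f w, w.1)) {p z : X × Y} (hze : z ∈ e.source)
    (hz : z ∈ connectedComponentIn (f ⁻¹' {c}) p) {U : Set Y} (hU : U ∈ 𝓝 z.2) :
    ∀ᶠ x in 𝓝 z.1, (Prod.mk x ⁻¹' connectedComponentIn (f ⁻¹' {c}) p ∩ U).Nonempty := by
  have hfz : f z = c := connectedComponentIn_subset (f ⁻¹' {c}) p hz
  have hez : e z = (c, z.1) := hfz ▸ he z
  -- The local section `g` of the first projection parametrizes the level set near `z`.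
  set g : X → X × Y := fun x => e.symm (c, x)
  set V : Set X := Prod.mk c ⁻¹' e.target
  have hV : IsOpen V := e.open_target.preimage (.prodMk_right c)
  have hzV : z.1 ∈ V := show (c, z.1) ∈ e.target from hez ▸ e.map_source hze
  have hgz : g z.1 = z := show e.symm (c, z.1) = z from hez ▸ e.left_inv hze
  have hg : ContinuousOn g V :=
    e.continuousOn_symm.comp (Continuous.prodMk_right c).continuousOn fun _ hx => hx
  have heg : ∀ x ∈ V, f (g x) = c ∧ (g x).1 = x := fun x hx =>
    Prod.mk.inj ((he (g x)).symm.trans (e.right_inv hx))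
  set W := connectedComponentIn V z.1
  have hWV : W ⊆ V := connectedComponentIn_subset _ _
  have hW : W ∈ 𝓝 z.1 := connectedComponentIn_mem_nhds (hV.mem_nhds hzV)
  have hgW : g '' W ⊆ connectedComponentIn (f ⁻¹' {c}) p := by
    rw [connectedComponentIn_eq hz]
    refine (isPreconnected_connectedComponentIn.image g (hg.mono hWV)).subset_connectedComponentIn
      ⟨z.1, mem_connectedComponentIn hzV, hgz⟩ ?_
    exact Set.image_subset_iff.2 fun x hx => (heg x (hWV hx)).1
  have hgU : ∀ᶠ x in 𝓝 z.1, (g x).2 ∈ U :=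
    (continuous_snd.continuousAt.comp (hg.continuousAt (hV.mem_nhds hzV))).eventually_mem
      (by rwa [Function.comp_apply, hgz])
  filter_upwards [hgU, hW] with x hxU hxW
  have hgx : g x = (x, (g x).2) := Prod.ext (heg x (hWV hxW)).2 rfl
  exact ⟨(g x).2, by rw [Set.mem_preimage, ← hgx]; exact hgW (Set.mem_image_of_mem g hxW), hxU⟩

end ImplicitFunction

section PlaneCurve

open Polynomial
open scoped Polynomial.Bivariate

/-- The affine plane curve `G = 0`. -/
def zeroLocus {R : Type*} [CommSemiring R] (G : R[X][Y]) : Set (R × R) :=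
  (fun z => G.evalEval z.1 z.2) ⁻¹' {0}

variable {𝕜 : Type*} [NontriviallyNormedField 𝕜]

theorem exists_hasStrictFDerivAt_evalEval (G : 𝕜[X][Y]) (z : 𝕜 × 𝕜) :
    ∃ f' : 𝕜 × 𝕜 →L[𝕜] 𝕜, HasStrictFDerivAt (fun z : 𝕜 × 𝕜 => G.evalEval z.1 z.2) f' z := by
  induction G using Polynomial.induction_on' with
  | add p q hp hq =>
    obtain ⟨p', hp⟩ := hp
    obtain ⟨q', hq⟩ := hq
    exact ⟨p' + q', by simpa only [evalEval_add] using! hp.add hq⟩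
  | monomial k a =>
    simp only [evalEval, eval_monomial, eval_mul, eval_pow, eval_C]
    exact ⟨_, ((a.hasStrictDerivAt z.1).comp_hasStrictFDerivAt z hasStrictFDerivAt_fst).mul
      (hasStrictFDerivAt_snd.pow k)⟩

theorem hasStrictFDerivAt_evalEval (G : 𝕜[X][Y]) (z : 𝕜 × 𝕜) :
    HasStrictFDerivAt (fun z : 𝕜 × 𝕜 => G.evalEval z.1 z.2)
      ((derivative (G.eval (C z.2))).eval z.1 • ContinuousLinearMap.fst 𝕜 𝕜 𝕜 +
        (derivative G).evalEval z.1 z.2 • ContinuousLinearMap.snd 𝕜 𝕜 𝕜) z := by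
  obtain ⟨f', hf'⟩ := exists_hasStrictFDerivAt_evalEval G z
  have hx : f' (1, 0) = (derivative (G.eval (C z.2))).eval z.1 :=
    (hf'.hasFDerivAt.comp_hasDerivAt z.1
      ((hasDerivAt_id z.1).prodMk (hasDerivAt_const z.1 z.2))).unique
      ((G.eval (C z.2)).hasDerivAt z.1)
  have hy : f' (0, 1) = (derivative G).evalEval z.1 z.2 := by
    refine (hf'.hasFDerivAt.comp_hasDerivAt z.2
      ((hasDerivAt_const z.2 z.1).prodMk (hasDerivAt_id z.2))).unique ?_
    simpa only [derivative_map, eval_map, eval₂_evalRingHom] using!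
      (G.map (evalRingHom z.1)).hasDerivAt z.2
  convert hf'
  ext <;> simp [hx, hy]

theorem continuous_evalEval (G : 𝕜[X][Y]) : Continuous fun z : 𝕜 × 𝕜 => G.evalEval z.1 z.2 :=
  continuous_iff_continuousAt.2 fun z => (hasStrictFDerivAt_evalEval G z).continuousAt

theorem isClosed_zeroLocus (G : 𝕜[X][Y]) : IsClosed (zeroLocus G) :=
  isClosed_singleton.preimage (continuous_evalEval G)

theorem exists_openPartialHomeomorph_eq_evalEval_prodMk [CompleteSpace 𝕜] {G : 𝕜[X][Y]}
    {z : 𝕜 × 𝕜} (hy : (derivative G).evalEval z.1 z.2 ≠ 0) :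
    ∃ e : OpenPartialHomeomorph (𝕜 × 𝕜) (𝕜 × 𝕜),
      z ∈ e.source ∧ ∀ w, e w = (G.evalEval w.1 w.2, w.1) := by
  refine exists_openPartialHomeomorph_eq_prodMk (hasStrictFDerivAt_evalEval G z)
    ⟨ContinuousLinearEquiv.unitsEquivAut 𝕜 (Units.mk0 _ hy), ?_⟩
  ext
  simp

theorem isProperAt_zeroLocus [ProperSpace 𝕜] {G : 𝕜[X][Y]} {x : 𝕜}
    (hx : G.leadingCoeff.eval x ≠ 0) : IsProperAt (zeroLocus G) x := by
  have h0 : G.reverse.evalEval x 0 ≠ 0 := by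
    rwa [evalEval, C_0, ← coeff_zero_eq_eval_zero, coeff_zero_reverse]
  have hne : ∀ᶠ z : 𝕜 × 𝕜 in 𝓝 (x, 0), G.reverse.evalEval z.1 z.2 ≠ 0 :=
    (continuous_evalEval G.reverse).continuousAt.eventually_ne h0
  obtain ⟨r, hr, hball⟩ := Metric.eventually_nhds_iff_ball.1 hne
  refine ⟨Metric.closedBall 0 r⁻¹, isCompact_closedBall 0 r⁻¹, ?_⟩
  filter_upwards [Metric.ball_mem_nhds x hr] with x' hx' y hy
  by_contra hlt
  rw [mem_closedBall_zero_iff, not_le] at hlt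
  have hy0 : y ≠ 0 := norm_pos_iff.1 ((inv_pos.2 hr).trans hlt)
  have hmem : (x', y⁻¹) ∈ Metric.ball (x, (0 : 𝕜)) r := by
    rw [← ball_prod_same, Set.mem_prod, mem_ball_zero_iff, norm_inv]
    exact ⟨hx', inv_lt_of_inv_lt₀ hr hlt⟩
  let _ := invertibleOfNonzero hy0
  refine hball _ hmem ?_
  rw [← eval₂_evalRingHom, ← invOf_eq_inv y, eval₂_reverse_eq_zero_iff, eval₂_evalRingHom]
  exact hy

end PlaneCurve

section SmoothComponent

open Polynomial
open scoped Polynomial.Bivariate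

theorem isClosed_connectedComponentIn {X : Type*} [TopologicalSpace X] {F : Set X}
    (hF : IsClosed F) (x : X) : IsClosed (connectedComponentIn F x) := by
  by_cases hx : x ∈ F
  · exact isClosed_of_closure_subset (isPreconnected_connectedComponentIn.closure
      |>.subset_connectedComponentIn (subset_closure (mem_connectedComponentIn hx))
      (closure_minimal (connectedComponentIn_subset F x) hF))
  · exact connectedComponentIn_eq_empty hx ▸ isClosed_empty

/-- `K` is a connected component of the plane curve `G = 0` at whose points `G` has non-zero
differential. This is `IsSmoothCurveComponent` in the coordinates of `ℝ × ℝ`. -/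
structure IsSmoothComponent (G : ℝ[X][Y]) (K : Set (ℝ × ℝ)) : Prop where
  exists_eq : ∃ p ∈ zeroLocus G, K = connectedComponentIn (zeroLocus G) p
  fderiv_ne_zero : ∀ z ∈ K, fderiv ℝ (fun z : ℝ × ℝ => G.evalEval z.1 z.2) z ≠ 0

namespace IsSmoothComponent

variable {G : ℝ[X][Y]} {K : Set (ℝ × ℝ)} {z : ℝ × ℝ}

theorem subset_zeroLocus (hK : IsSmoothComponent G K) : K ⊆ zeroLocus G := by
  obtain ⟨p, -, rfl⟩ := hK.exists_eq
  exact connectedComponentIn_subset _ _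

theorem isClosed (hK : IsSmoothComponent G K) : IsClosed K := by
  obtain ⟨p, -, rfl⟩ := hK.exists_eq
  exact isClosed_connectedComponentIn (isClosed_zeroLocus G) p

theorem ne_zero (hK : IsSmoothComponent G K) : G ≠ 0 := by
  obtain ⟨p, hp, rfl⟩ := hK.exists_eq
  rintro rfl
  refine hK.fderiv_ne_zero p (mem_connectedComponentIn hp) ?_
  simp only [evalEval_zero, fderiv_fun_const, Pi.zero_apply]

theorem map_evalRingHom_ne_zero (hK : IsSmoothComponent G K)
    (hline : ¬ ContainsVerticalLine Prod.fst K) (hz : z ∈ K) : G.map (evalRingHom z.1) ≠ 0 := by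
  intro h0
  obtain ⟨p, -, rfl⟩ := hK.exists_eq
  refine hline ⟨z.1, ?_⟩
  have hfiber : Prod.fst ⁻¹' {z.1} = ({z.1} : Set ℝ) ×ˢ (Set.univ : Set ℝ) :=
    (Set.prod_univ).symm
  rw [connectedComponentIn_eq hz, hfiber]
  refine (isPreconnected_singleton.prod isPreconnected_univ).subset_connectedComponentIn
    ⟨rfl, Set.mem_univ _⟩ fun w hw => ?_
  change G.evalEval w.1 w.2 = 0
  rw [show w.1 = z.1 from hw.1, ← eval₂_evalRingHom, ← eval_map, h0, eval_zero]

theorem finite_fiber (hK : IsSmoothComponent G K) (hline : ¬ ContainsVerticalLine Prod.fst K)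
    (x : ℝ) : (Prod.mk x ⁻¹' K).Finite := by
  rcases (Prod.mk x ⁻¹' K).eq_empty_or_nonempty with hempty | ⟨y₀, hy₀⟩
  · exact hempty ▸ Set.finite_empty
  · refine (finite_setOfPred_isRoot (hK.map_evalRingHom_ne_zero hline hy₀)).subset fun y hy => ?_
    change (G.map (evalRingHom x)).eval y = 0
    rw [eval_map, eval₂_evalRingHom]
    exact hK.subset_zeroLocus hy

theorem fst_mem_verticalTangencies (hK : IsSmoothComponent G K)
    (hline : ¬ ContainsVerticalLine Prod.fst K) (hz : z ∈ K)
    (hy : (derivative G).evalEval z.1 z.2 = 0) : z.1 ∈ verticalTangencies G := by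
  refine ⟨z.2, hK.subset_zeroLocus hz, hy, fun hx => hK.fderiv_ne_zero z hz ?_,
    hK.map_evalRingHom_ne_zero hline hz⟩
  rw [(hasStrictFDerivAt_evalEval G z).hasFDerivAt.fderiv, hx, hy, zero_smul, zero_smul, add_zero]

theorem lowerHemicontinuousAt (hK : IsSmoothComponent G K)
    (hline : ¬ ContainsVerticalLine Prod.fst K) {x : ℝ} (hx : x ∉ verticalTangencies G) :
    LowerHemicontinuousAt (fun x => Prod.mk x ⁻¹' K) x := by
  rintro U ⟨hU, y, hy, hyU⟩
  have hder : (derivative G).evalEval x y ≠ 0 :=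
    fun h => hx (hK.fst_mem_verticalTangencies hline hy h)
  obtain ⟨e, hze, he⟩ := exists_openPartialHomeomorph_eq_evalEval_prodMk (z := (x, y)) hder
  obtain ⟨p, -, rfl⟩ := hK.exists_eq
  exact (eventually_fiber_connectedComponentIn_inter_nonempty he hze hy (hU.mem_nhds hyU)).mono
    fun x' hx' => ⟨hU, hx'⟩

theorem isProperMap_fst (hK : IsSmoothComponent G K) (hline : ¬ ContainsVerticalLine Prod.fst K)
    (hasymp : ¬ HasVerticalAsymptote Prod.fst K) : IsProperMap (K.domRestrict Prod.fst) := by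
  refine isProperMap_fst_of_forall_isProperAt hK.isClosed fun t =>
    isProperAt_of_not_hasVerticalAsymptote hK.isClosed (hK.finite_fiber hline t).isCompact ?_ hasymp
  have htan : ∀ᶠ x in 𝓝[≠] t, x ∉ verticalTangencies G :=
    mem_of_superset (nhdsNE_of_nhdsNE_sdiff_finite univ_mem (finite_verticalTangencies G))
      fun _ hx => hx.2
  have hlead : ∀ᶠ x in 𝓝[≠] t, G.leadingCoeff.eval x ≠ 0 :=
    mem_of_superset (nhdsNE_of_nhdsNE_sdiff_finite univ_mem
      (finite_setOfPred_isRoot (leadingCoeff_ne_zero.2 hK.ne_zero))) fun _ hx => hx.2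
  filter_upwards [htan, hlead] with x hx hx'
  obtain ⟨C, hC, hsub⟩ := isProperAt_zeroLocus hx'
  exact ⟨hK.lowerHemicontinuousAt hline hx, C, hC,
    hsub.mono fun x h => (Set.preimage_mono hK.subset_zeroLocus).trans h⟩

theorem derivative_eq_zero_of_mem_topCriticalSet (hK : IsSmoothComponent G K)
    (hz : z ∈ topCriticalSet Prod.fst K) : (derivative G).evalEval z.1 z.2 = 0 := by
  by_contra hy
  obtain ⟨e, hze, he⟩ := exists_openPartialHomeomorph_eq_evalEval_prodMk hy
  exact hz.2 ⟨e.source, e.open_source, hze, (isEmbedding_fst_source_inter_fiber he).comp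
    (.inclusion (Set.inter_subset_inter_right _ hK.subset_zeroLocus))⟩

theorem finite_topCriticalSet (hK : IsSmoothComponent G K)
    (hline : ¬ ContainsVerticalLine Prod.fst K) : (topCriticalSet Prod.fst K).Finite := by
  refine ((finite_verticalTangencies G).biUnion fun x _ =>
    (hK.finite_fiber hline x).image (Prod.mk x)).subset fun z hz => ?_
  exact Set.mem_biUnion (hK.fst_mem_verticalTangencies hline hz.1
    (hK.derivative_eq_zero_of_mem_topCriticalSet hz)) ⟨z.2, hz.1, rfl⟩

end IsSmoothComponent
end SmoothComponent

section ProperRestriction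

theorem image_val_domRestrict_preimage {P Z : Type*} (π : P → Z) (C : Set P) (S : Set Z) :
    Subtype.val '' (C.domRestrict π ⁻¹' S) = C ∩ π ⁻¹' S :=
  Subtype.image_preimage_coe C (π ⁻¹' S)

variable {P Z : Type*} [TopologicalSpace P] [TopologicalSpace Z] [T2Space Z]
  [WeaklyLocallyCompactSpace Z] {π : P → Z} {C D : Set P}

theorem isProperMap_domRestrict_iff_isCompact_inter_preimage (hπ : Continuous π) :
    IsProperMap (C.domRestrict π) ↔ ∀ S, IsCompact S → IsCompact (C ∩ π ⁻¹' S) := by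
  have hcont : Continuous (C.domRestrict π) := hπ.comp continuous_subtype_val
  simp only [isProperMap_iff_isCompact_preimage, Subtype.isCompact_iff,
    image_val_domRestrict_preimage, hcont, true_and]

theorem isProperMap_domRestrict_mono (hπ : Continuous π) (hD : IsProperMap (D.domRestrict π))
    (hC : IsClosed C) (hCD : C ⊆ D) : IsProperMap (C.domRestrict π) := by
  rw [isProperMap_domRestrict_iff_isCompact_inter_preimage hπ] at hD ⊢
  exact fun S hS => (hD S hS).of_isClosed_subset (hC.inter (hS.isClosed.preimage hπ))
    (Set.inter_subset_inter_left _ hCD)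

theorem isProperMap_domRestrict_sUnion (hπ : Continuous π) {𝒦 : Set (Set P)} (hfin : 𝒦.Finite)
    (h : ∀ K ∈ 𝒦, IsProperMap (K.domRestrict π)) : IsProperMap ((⋃₀ 𝒦).domRestrict π) := by
  rw [isProperMap_domRestrict_iff_isCompact_inter_preimage hπ]
  intro S hS
  rw [Set.sUnion_eq_biUnion, Set.iUnion₂_inter]
  exact hfin.isCompact_biUnion fun K hK =>
    (isProperMap_domRestrict_iff_isCompact_inter_preimage hπ).1 (h K hK) S hS

theorem isProperMap_domRestrict_preimage_iff {Q : Type*} [TopologicalSpace Q] (φ : P ≃ₜ Q)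
    {ρ : Q → Z} (hρ : Continuous ρ) {K : Set Q} :
    IsProperMap ((φ ⁻¹' K).domRestrict (ρ ∘ φ)) ↔ IsProperMap (K.domRestrict ρ) := by
  simp only [isProperMap_domRestrict_iff_isCompact_inter_preimage hρ,
    isProperMap_domRestrict_iff_isCompact_inter_preimage (hρ.comp φ.continuous),
    Set.preimage_comp, ← Set.preimage_inter, φ.isCompact_preimage]

end ProperRestriction

section VerticalLines

theorem ContainsVerticalLine.mono {P : Type*} {π : P → ℝ} {C C' : Set P}
    (h : ContainsVerticalLine π C) (hC : C ⊆ C') : ContainsVerticalLine π C' :=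
  h.imp fun _ ht => ht.trans hC

theorem ContainsVerticalLine.preimage {P Q : Type*} {ρ : Q → ℝ} {K : Set Q} (φ : P → Q)
    (h : ContainsVerticalLine ρ K) : ContainsVerticalLine (ρ ∘ φ) (φ ⁻¹' K) :=
  h.imp fun _ ht => Set.preimage_mono ht

variable {P Q : Type*} [TopologicalSpace P] [TopologicalSpace Q] {π : P → ℝ} {ρ : Q → ℝ}
  {C : Set P} {K : Set Q}

theorem not_containsVerticalLine_of_isProperMap (hπ : Continuous π)
    (hfiber : ∀ t, ¬ IsCompact (π ⁻¹' {t})) (h : IsProperMap (C.domRestrict π)) :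
    ¬ ContainsVerticalLine π C := by
  rintro ⟨t, ht⟩
  refine hfiber t (Set.inter_eq_right.2 ht ▸ ?_)
  exact (isProperMap_domRestrict_iff_isCompact_inter_preimage hπ).1 h {t} isCompact_singleton

theorem not_hasVerticalAsymptote_of_isProperMap (hπ : Continuous π)
    (h : IsProperMap (C.domRestrict π)) : ¬ HasVerticalAsymptote π C := by
  rintro ⟨t, γ, -, -, hmem, hinf, ht⟩
  have hcompact : IsCompact (C ∩ π ⁻¹' Metric.closedBall t 1) :=
    (isProperMap_domRestrict_iff_isCompact_inter_preimage hπ).1 h _ (isCompact_closedBall t 1)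
  obtain ⟨s, hs, hs'⟩ := ((hinf.eventually hcompact.compl_mem_cocompact).and
    (ht.eventually (Metric.closedBall_mem_nhds t one_pos))).exists
  exact hs ⟨hmem s, hs'⟩

theorem HasVerticalAsymptote.mono {C' : Set P} (h : HasVerticalAsymptote π C) (hC : C ⊆ C') :
    HasVerticalAsymptote π C' :=
  let ⟨t, γ, hcont, hinj, hmem, hlim⟩ := h
  ⟨t, γ, hcont, hinj, fun s => hC (hmem s), hlim⟩

theorem HasVerticalAsymptote.preimage (φ : P ≃ₜ Q) (h : HasVerticalAsymptote ρ K) :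
    HasVerticalAsymptote (ρ ∘ φ) (φ ⁻¹' K) := by
  refine .of_preimage (π := ρ) φ.symm.isClosedEmbedding continuous_id (fun q => ?_) ?_
  · simp only [Function.comp_apply, φ.apply_symm_apply, id]
  · rwa [← Set.preimage_comp, φ.self_comp_symm, Set.preimage_id]

end VerticalLines

section CriticalSet

variable {P Q : Type*} [TopologicalSpace P] [TopologicalSpace Q]

theorem topCriticalSet_sUnion_subset {𝒦 : Set (Set P)} (hfin : 𝒦.Finite)
    (hdisj : 𝒦.PairwiseDisjoint id) (hclosed : ∀ K ∈ 𝒦, IsClosed K) (π : P → ℝ) :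
    topCriticalSet π (⋃₀ 𝒦) ⊆ ⋃ K ∈ 𝒦, topCriticalSet π K := by
  rintro p ⟨⟨K, hK, hp⟩, hcrit⟩
  refine Set.mem_biUnion hK ⟨hp, fun ⟨U, hU, hpU, hemb⟩ => hcrit ?_⟩
  set O : Set P := (⋃ K' ∈ 𝒦 \ {K}, K')ᶜ
  have hO : IsOpen O :=
    (hfin.sdiff.isClosed_biUnion fun K' hK' => hclosed K' hK'.1).isOpen_compl
  have hpO : p ∈ O := fun h => by
    obtain ⟨K', hK', hpK'⟩ := Set.mem_iUnion₂.1 h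
    exact Set.disjoint_left.1 (hdisj hK'.1 hK hK'.2) hpK' hp
  have hsub : U ∩ O ∩ ⋃₀ 𝒦 ⊆ U ∩ K := by
    rintro q ⟨⟨hqU, hqO⟩, K', hK', hqK'⟩
    refine ⟨hqU, by_contra fun hqK => hqO (Set.mem_biUnion (x := K') ⟨hK', ?_⟩ hqK')⟩
    rintro rfl
    exact hqK hqK'
  exact ⟨U ∩ O, hU.inter hO, ⟨hpU, hpO⟩, hemb.comp (.inclusion hsub)⟩

theorem topCriticalSet_preimage_subset (φ : P ≃ₜ Q) (ρ : Q → ℝ) (K : Set Q) :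
    topCriticalSet (ρ ∘ φ) (φ ⁻¹' K) ⊆ φ ⁻¹' topCriticalSet ρ K := by
  rintro p ⟨hp, hcrit⟩
  refine ⟨hp, fun ⟨U, hU, hpU, hemb⟩ => hcrit ⟨φ ⁻¹' U, hU.preimage φ.continuous, hpU, ?_⟩⟩
  exact hemb.comp (φ.isEmbedding.restrictPreimage (U ∩ K))

end CriticalSet

section Frontier

theorem disjoint_of_disjoint_frontier {X : Type*} [TopologicalSpace X] {S D : Set X}
    (hS : IsPreconnected S) (hD : IsClosed D) (hfr : Disjoint S (frontier D))
    (hne : (S ∩ Dᶜ).Nonempty) : Disjoint S D := by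
  rw [← Set.subset_compl_iff_disjoint_right]
  refine hS.subset_right_of_subset_union (u := interior D) isOpen_interior hD.isOpen_compl
    (Set.disjoint_compl_right_iff_subset.2 interior_subset) (fun x hx => ?_) hne
  refine or_iff_not_imp_left.2 fun hxi hxD => Set.disjoint_left.1 hfr hx ?_
  exact hD.frontier_eq ▸ ⟨hxD, hxi⟩

theorem mem_upperBounds_image_snd_of_frontier {X Y : Type*} [TopologicalSpace X]
    [ConditionallyCompleteLinearOrder Y] [DenselyOrdered Y] [NoMaxOrder Y] [TopologicalSpace Y]
    [OrderTopology Y] {D : Set (X × Y)} (hD : IsClosed D) {S : Set X} (hS : IsPreconnected S)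
    {t : X} (ht : t ∈ S) {c : Y}
    (hc : c ∈ upperBounds (Prod.snd '' (D ∩ Prod.fst ⁻¹' {t})))
    (hfr : c ∈ upperBounds (Prod.snd '' (frontier D ∩ Prod.fst ⁻¹' S))) :
    c ∈ upperBounds (Prod.snd '' (D ∩ Prod.fst ⁻¹' S)) := by
  rintro _ ⟨z, ⟨hzD, hzS⟩, rfl⟩
  obtain ⟨d, hd⟩ := exists_gt c
  by_contra hlt
  refine Set.disjoint_left.1 (disjoint_of_disjoint_frontier (hS.prod isPreconnected_Ioi) hD
    (Set.disjoint_left.2 fun w hw hwD => ?_) ⟨(t, d), ⟨ht, hd⟩, fun htd => ?_⟩)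
    ⟨hzS, not_le.1 hlt⟩ hzD
  · exact (show c < w.2 from hw.2).not_ge (hfr (Set.mem_image_of_mem _ ⟨hwD, hw.1⟩))
  · exact (show c < d from hd).not_ge (hc ⟨(t, d), ⟨htd, rfl⟩, rfl⟩)

variable {X Y : Type*} [ConditionallyCompleteLinearOrder X] [DenselyOrdered X]
  [TopologicalSpace X] [OrderTopology X] [WeaklyLocallyCompactSpace X]
  [ConditionallyCompleteLinearOrder Y] [DenselyOrdered Y] [TopologicalSpace Y] [OrderTopology Y]
  {D : Set (X × Y)}

theorem bddAbove_image_snd_of_frontier [NoMaxOrder Y] (hD : IsClosed D)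
    (hfr : IsProperMap ((frontier D).domRestrict Prod.fst)) {t : X}
    (ht : IsCompact (D ∩ Prod.fst ⁻¹' {t})) {S : Set X} (hS : IsCompact S) :
    BddAbove (Prod.snd '' (D ∩ Prod.fst ⁻¹' S)) := by
  obtain ⟨m, hm⟩ := (hS.insert t).bddBelow
  obtain ⟨M, hM⟩ := (hS.insert t).bddAbove
  have hfrI : IsCompact (frontier D ∩ Prod.fst ⁻¹' Set.Icc m M) :=
    (isProperMap_domRestrict_iff_isCompact_inter_preimage continuous_fst).1 hfr _ isCompact_Icc
  obtain ⟨c, hc⟩ := (hfrI.image continuous_snd).bddAbove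
  obtain ⟨c', hc'⟩ := (ht.image continuous_snd).bddAbove
  have hSI : S ⊆ Set.Icc m M := fun x hx => ⟨hm (.inr hx), hM (.inr hx)⟩
  have hmax := mem_upperBounds_image_snd_of_frontier hD isPreconnected_Icc
    (show t ∈ Set.Icc m M from ⟨hm (Set.mem_insert t S), hM (Set.mem_insert t S)⟩)
    (upperBounds_mono_mem (le_max_right c c') hc') (upperBounds_mono_mem (le_max_left c c') hc)
  exact ⟨max c c', upperBounds_mono_set (Set.image_mono (Set.inter_subset_inter_right _
    (Set.preimage_mono hSI))) hmax⟩

theorem isProperMap_fst_of_frontier [NoMaxOrder Y] [NoMinOrder Y] (hD : IsClosed D)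
    (hfr : IsProperMap ((frontier D).domRestrict Prod.fst)) {t : X}
    (ht : IsCompact (D ∩ Prod.fst ⁻¹' {t})) : IsProperMap (D.domRestrict Prod.fst) := by
  rw [isProperMap_domRestrict_iff_isCompact_inter_preimage continuous_fst]
  intro S hS
  obtain ⟨M, hM⟩ := bddAbove_image_snd_of_frontier hD hfr ht hS
  obtain ⟨m, hm⟩ := bddAbove_image_snd_of_frontier (Y := Yᵒᵈ) hD hfr ht hS
  exact (hS.prod isCompact_Icc).of_isClosed_subset
    (hD.inter (hS.isClosed.preimage continuous_fst)) fun z hz =>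
    ⟨hz.2, hm (Set.mem_image_of_mem _ hz), hM (Set.mem_image_of_mem _ hz)⟩

end Frontier

section AffineCoordinates

theorem hasFDerivAt_eval {𝕜 σ : Type*} [NontriviallyNormedField 𝕜] [Fintype σ]
    (F : MvPolynomial σ 𝕜) (x : σ → 𝕜) :
    HasFDerivAt (fun x => MvPolynomial.eval x F)
      (∑ i, MvPolynomial.eval x (MvPolynomial.pderiv i F) •
        (ContinuousLinearMap.proj i : (σ → 𝕜) →L[𝕜] 𝕜)) x := by
  classical
  induction F using MvPolynomial.induction_on with
  | C a =>
    simp only [MvPolynomial.eval_C]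
    convert! hasFDerivAt_const (𝕜 := 𝕜) a x using 1
    ext v
    simp
  | add p q hp hq =>
    simp only [map_add]
    convert! hp.fun_add hq using 1
    ext v
    simp [add_mul, Finset.sum_add_distrib]
  | mul_X p i hp =>
    simp only [map_mul, MvPolynomial.eval_X]
    convert! hp.fun_mul (hasFDerivAt_apply i x) using 1
    ext v
    simp [MvPolynomial.pderiv_X, Pi.single_apply, apply_ite, add_mul, Finset.sum_add_distrib,
      Finset.mul_sum, mul_assoc]

theorem fderiv_eval_comp_ne_zero {𝕜 σ E : Type*} [NontriviallyNormedField 𝕜] [Finite σ]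
    [NormedAddCommGroup E] [NormedSpace 𝕜 E] {L : E →ᴬ[𝕜] σ → 𝕜} (hL : Function.Surjective L)
    {F : MvPolynomial σ 𝕜} {z : E} {i : σ}
    (hi : MvPolynomial.eval (L z) (MvPolynomial.pderiv i F) ≠ 0) :
    fderiv 𝕜 (fun z => MvPolynomial.eval (L z) F) z ≠ 0 := by
  classical
  have := Fintype.ofFinite σ
  have hderiv : HasFDerivAt (fun z => MvPolynomial.eval (L z) F) _ z :=
    (hasFDerivAt_eval F (L z)).comp z L.hasFDerivAt
  obtain ⟨v, hv⟩ := (AffineMap.linear_surjective_iff L.toAffineMap).2 hL (Pi.single i 1)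
  have hv' : L.contLinear v = Pi.single i 1 := hv
  refine fun h => hi ?_
  simpa [hv', Pi.single_apply] using DFunLike.congr_fun (hderiv.fderiv.symm.trans h) v

section Polynomial

open Polynomial
open scoped Polynomial.Bivariate

theorem exists_evalEval_eq_eval_comp {R σ : Type*} [CommRing R] (L : R × R →ᵃ[R] σ → R)
    (F : MvPolynomial σ R) :
    ∃ G : R[X][Y], ∀ z : R × R, G.evalEval z.1 z.2 = MvPolynomial.eval (L z) F := by
  have hL : ∀ z i, L z i = L.linear (1, 0) i * z.1 + L.linear (0, 1) i * z.2 + L 0 i := by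
    intro z i
    have hz : z = z.1 • ((1, 0) : R × R) + z.2 • ((0, 1) : R × R) := by simp
    have hlin : L.linear z = z.1 • L.linear (1, 0) + z.2 • L.linear (0, 1) := by
      rw [← map_smul, ← map_smul, ← map_add, ← hz]
    rw [L.decomp]
    simp [hlin, mul_comm]
  set f : σ → R[X][Y] := fun i =>
    C (C (L.linear (1, 0) i) * X) + C (C (L.linear (0, 1) i)) * X + C (C (L 0 i))
  refine ⟨MvPolynomial.aeval f F, fun z => ?_⟩
  induction F using MvPolynomial.induction_on with
  | C r => simp [evalEval]
  | add p q hp hq => simp only [map_add, evalEval_add, hp, hq]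
  | mul_X p i hp =>
    rw [map_mul, evalEval_mul, hp, map_mul, MvPolynomial.aeval_X, MvPolynomial.eval_X, hL]
    simp [f, evalEval]

end Polynomial

theorem exists_linearEquiv_prod_fst_eq {K V : Type*} [Field K] [AddCommGroup V] [Module K V]
    (hV : Module.finrank K V = 2) {f : V →ₗ[K] K} (hf : f ≠ 0) :
    ∃ e : V ≃ₗ[K] K × K, ∀ v, (e v).1 = f v := by
  have : FiniteDimensional K V := Module.finite_of_finrank_eq_succ hV
  have hsurj : Function.Surjective f := LinearMap.surjective hf
  have hker : Module.finrank K (LinearMap.ker f) = 1 := by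
    have h := LinearMap.finrank_range_add_finrank_ker f
    rw [LinearMap.range_eq_top.2 hsurj, finrank_top, Module.finrank_self, hV] at h
    omega
  obtain ⟨e⟩ := Module.nonempty_linearEquiv_of_finrank_eq_one hker
  obtain ⟨W, hW⟩ := Submodule.exists_isCompl (LinearMap.ker f)
  set g : V →ₗ[K] K := e.symm ∘ₗ (LinearMap.ker f).projectionOnto W hW
  have hg : LinearMap.ker g = W := by
    rw [LinearEquiv.ker_comp, Submodule.ker_projectionOnto]
  have hgsurj : Function.Surjective g :=
    e.symm.surjective.comp (Submodule.projectionOnto_surjective hW)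
  exact ⟨f.equivProdOfSurjectiveOfIsCompl g (LinearMap.range_eq_top.2 hsurj)
    (LinearMap.range_eq_top.2 hgsurj) (hg ▸ hW), fun _ => rfl⟩

variable {V P : Type*} [AddCommGroup V] [Module ℝ V] [TopologicalSpace V]
  [IsTopologicalAddGroup V] [ContinuousSMul ℝ V] [T2Space V] [AddTorsor V P]
  [TopologicalSpace P] [IsTopologicalAddTorsor P]

theorem exists_continuousAffineEquiv_fst_eq (hV : Module.finrank ℝ V = 2) {π : P →ᵃ[ℝ] ℝ}
    (hπ : π.linear ≠ 0) : ∃ Φ : P ≃ᴬ[ℝ] ℝ × ℝ, ⇑π = Prod.fst ∘ Φ := by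
  have : FiniteDimensional ℝ V := Module.finite_of_finrank_eq_succ hV
  obtain ⟨ψ, hψ⟩ := exists_linearEquiv_prod_fst_eq hV hπ
  obtain ⟨p₀⟩ : Nonempty P := inferInstance
  let Φ : P ≃ᵃ[ℝ] ℝ × ℝ := (AffineEquiv.vaddConst ℝ p₀).symm.trans
    (ψ.toAffineEquiv.trans (AffineEquiv.constVAdd ℝ (ℝ × ℝ) (π p₀, 0)))
  refine ⟨⟨Φ, AffineMap.continuous_linear_iff.1
    (LinearMap.continuous_of_finiteDimensional Φ.toAffineMap.linear),
    AffineMap.continuous_linear_iff.1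
    (LinearMap.continuous_of_finiteDimensional Φ.symm.toAffineMap.linear)⟩, funext fun p => ?_⟩
  change π p = π p₀ + (ψ (p -ᵥ p₀)).1
  rw [hψ, AffineMap.linearMap_vsub, vsub_eq_sub, add_sub_cancel]

end AffineCoordinates

section SmoothCurveComponent

variable {V P : Type*} [AddCommGroup V] [Module ℝ V] [AddTorsor V P] [TopologicalSpace P]
  {K : Set P}

theorem IsSmoothCurveComponent.exists_isSmoothComponent (hK : IsSmoothCurveComponent K)
    (Φ : P ≃ᴬ[ℝ] ℝ × ℝ) : ∃ G K', IsSmoothComponent G K' ∧ K = Φ ⁻¹' K' := by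
  obtain ⟨e, F, ⟨p, hp, rfl⟩, hgrad⟩ := hK
  set L : ℝ × ℝ ≃ᵃ[ℝ] Fin 2 → ℝ := Φ.toAffineEquiv.symm.trans e
  have hL : Continuous L := AffineMap.continuous_linear_iff.1
    (LinearMap.continuous_of_finiteDimensional L.toAffineMap.linear)
  have he : ∀ q, L (Φ q) = e q := fun q => congrArg e (Φ.symm_apply_apply q)
  obtain ⟨G, hG⟩ := exists_evalEval_eq_eval_comp L.toAffineMap F
  have hlocus : Φ '' {q | MvPolynomial.eval (e q) F = 0} = zeroLocus G := by
    rw [Φ.image_eq_preimage_symm]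
    exact Set.ext fun z => Eq.congr_left (hG z).symm
  have hcomp : Φ '' connectedComponentIn {q | MvPolynomial.eval (e q) F = 0} p =
      connectedComponentIn (zeroLocus G) (Φ p) :=
    hlocus ▸ Φ.toHomeomorph.image_connectedComponentIn hp
  refine ⟨G, _, ⟨⟨Φ p, hlocus ▸ Set.mem_image_of_mem Φ hp, rfl⟩, ?_⟩,
    (Φ.preimage_image _).symm.trans (congrArg _ hcomp)⟩
  rw [← hcomp, funext hG]
  rintro _ ⟨q, hq, rfl⟩
  obtain ⟨i, hi⟩ := hgrad q hq
  exact fderiv_eval_comp_ne_zero (L := ⟨L.toAffineMap, hL⟩) L.surjective ((he q).symm ▸ hi)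

theorem IsSmoothCurveComponent.isClosed (hK : IsSmoothCurveComponent K) (Φ : P ≃ᴬ[ℝ] ℝ × ℝ) :
    IsClosed K := by
  obtain ⟨G, K', hK', rfl⟩ := hK.exists_isSmoothComponent Φ
  exact hK'.isClosed.preimage Φ.continuous

theorem IsSmoothCurveComponent.isProperMap (hK : IsSmoothCurveComponent K) (Φ : P ≃ᴬ[ℝ] ℝ × ℝ)
    (hline : ¬ ContainsVerticalLine (Prod.fst ∘ Φ) K)
    (hasymp : ¬ HasVerticalAsymptote (Prod.fst ∘ Φ) K) :
    IsProperMap (K.domRestrict (Prod.fst ∘ Φ)) := by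
  obtain ⟨G, K', hK', rfl⟩ := hK.exists_isSmoothComponent Φ
  exact (isProperMap_domRestrict_preimage_iff Φ.toHomeomorph continuous_fst).2
    (hK'.isProperMap_fst (fun h => hline (h.preimage Φ))
      fun h => hasymp (h.preimage Φ.toHomeomorph))

theorem IsSmoothCurveComponent.finite_topCriticalSet (hK : IsSmoothCurveComponent K)
    (Φ : P ≃ᴬ[ℝ] ℝ × ℝ) (hline : ¬ ContainsVerticalLine (Prod.fst ∘ Φ) K) :
    (topCriticalSet (Prod.fst ∘ Φ) K).Finite := by
  obtain ⟨G, K', hK', rfl⟩ := hK.exists_isSmoothComponent Φ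
  exact ((hK'.finite_topCriticalSet fun h => hline (h.preimage Φ)).preimage
    Φ.injective.injOn).subset (topCriticalSet_preimage_subset Φ.toHomeomorph Prod.fst K')

end SmoothCurveComponent

section Coordinates

variable {P : Type*} [TopologicalSpace P] (Φ : P ≃ₜ ℝ × ℝ) {D : Set P}

theorem not_isCompact_preimage_fst_comp (t : ℝ) : ¬ IsCompact ((Prod.fst ∘ Φ) ⁻¹' {t}) := by
  rw [Set.preimage_comp, Φ.isCompact_preimage]
  intro h
  refine noncompact_univ ℝ ((h.image continuous_snd).of_isClosed_subset isClosed_univ ?_)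
  exact fun y _ => ⟨(t, y), rfl, rfl⟩

theorem isProperMap_fst_comp_of_frontier (hD : IsClosed D)
    (hfr : IsProperMap ((frontier D).domRestrict (Prod.fst ∘ Φ))) {t : ℝ}
    (ht : IsCompact (D.domRestrict (Prod.fst ∘ Φ) ⁻¹' {t})) :
    IsProperMap (D.domRestrict (Prod.fst ∘ Φ)) := by
  obtain ⟨D, rfl⟩ := Φ.injective.preimage_surjective D
  rw [Subtype.isCompact_iff, image_val_domRestrict_preimage, Set.preimage_comp,
    ← Set.preimage_inter, Φ.isCompact_preimage] at ht
  rw [← Φ.preimage_frontier, isProperMap_domRestrict_preimage_iff Φ continuous_fst] at hfr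
  rw [isProperMap_domRestrict_preimage_iff Φ continuous_fst]
  exact isProperMap_fst_of_frontier (Φ.isClosed_preimage.1 hD) hfr ht

theorem nonempty_frontier_of_isProperMap (hne : D.Nonempty)
    (h : IsProperMap (D.domRestrict (Prod.fst ∘ Φ))) : (frontier D).Nonempty := by
  have : PreconnectedSpace P :=
    ⟨Φ.symm.surjective.range_eq ▸ isPreconnected_range Φ.symm.continuous⟩
  refine nonempty_frontier_iff.2 ⟨hne, ?_⟩
  rintro rfl
  exact not_containsVerticalLine_of_isProperMap (continuous_fst.comp Φ.continuous)
    (not_isCompact_preimage_fst_comp Φ) h ⟨0, Set.subset_univ _⟩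

end Coordinates

end AlgDomain

open AlgDomain in
theorem mainTheorem9 {V P : Type*} [AddCommGroup V] [Module ℝ V] [TopologicalSpace V]
    [IsTopologicalAddGroup V] [ContinuousSMul ℝ V] [T2Space V]
    [AddTorsor V P] [TopologicalSpace P] [IsTopologicalAddTorsor P]
    (hV : Module.finrank ℝ V = 2)
    (π : P →ᵃ[ℝ] ℝ) (hπ : π.linear ≠ 0)
    (D : Set P) (hne : D.Nonempty) (hD : AlgDomain.IsAlgebraicDomain D) :
    List.TFAE [
      AlgDomain.IsDomainOfFiniteType π D,
      IsProperMap (D.domRestrict π),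
      (∃ t : ℝ, IsCompact (D.domRestrict π ⁻¹' {t})) ∧
        ¬ AlgDomain.ContainsVerticalLine π (frontier D) ∧
        ¬ AlgDomain.HasVerticalAsymptote π (frontier D)] := by
  obtain ⟨Φ, hΦ⟩ := exists_continuousAffineEquiv_fst_eq hV hπ
  obtain ⟨hclosed, hsurf, 𝒦, hfin, hdisj, hK, hfr⟩ := hD
  rw [hΦ]
  have hcont : Continuous (Prod.fst ∘ Φ) := continuous_fst.comp Φ.continuous
  have hmem : ∀ K ∈ 𝒦, K ⊆ frontier D := fun K hK𝒦 => hfr ▸ Set.subset_sUnion_of_mem hK𝒦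
  tfae_have 1 → 2 := (·.isProper)
  tfae_have 2 → 3 := fun h =>
    have hC := isProperMap_domRestrict_mono hcont h isClosed_frontier hclosed.frontier_subset
    ⟨⟨0, h.isCompact_preimage isCompact_singleton⟩,
      not_containsVerticalLine_of_isProperMap hcont
        (not_isCompact_preimage_fst_comp Φ.toHomeomorph) hC,
      not_hasVerticalAsymptote_of_isProperMap hcont hC⟩
  tfae_have 3 → 2 := fun ⟨⟨t, ht⟩, hline, hasymp⟩ =>
    isProperMap_fst_comp_of_frontier Φ.toHomeomorph hclosed
      (hfr ▸ isProperMap_domRestrict_sUnion hcont hfin fun K hK𝒦 => (hK K hK𝒦).isProperMap Φ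
        (fun h => hline (h.mono (hmem K hK𝒦))) fun h => hasymp (h.mono (hmem K hK𝒦))) ht
  tfae_have 2 → 1 := fun h =>
    have hline := (tfae_2_to_3 h).2.1
    ⟨hclosed, hsurf, nonempty_frontier_of_isProperMap Φ.toHomeomorph hne h, h,
      hfr ▸ (hfin.biUnion fun K hK𝒦 => (hK K hK𝒦).finite_topCriticalSet Φ
        fun h => hline (h.mono (hmem K hK𝒦))).subset
        (topCriticalSet_sUnion_subset hfin hdisj (fun K hK𝒦 => (hK K hK𝒦).isClosed Φ) _)⟩
  tfae_finish
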